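/- **Theorem (Asymptotic normality of the heteroskedastic BOLS statistic).** Fix a number of batches $T\ge 1$, arm means $\mu_{a,t}\in\mathbb R$ and, for $a\in\{0,1\}$ and $t=1,\dots,T$, probability laws $\nu_{a,t}$ on $\mathbb R$ with mean $0$ and finite variance $\sigma_{a,t}^2$, where for each $t$ the variances $\sigma^2_{0,t},\sigma^2_{1,t}$ are not both zero. For each $k\in\mathbb N$ consider an experiment in $T$ batches, with $n_t=n_t^{(k)}$ units in batch $t$ (the index $k$ is suppressed below). Unit $i$ of batch $t$ has potential outcomes $Y_{i,t}(a)=\mu_{a,t}+\varepsilon_{i,t}(a)$, is assigned to an arm $A_{i,t}\in\{0,1\}$, and $Y_{i,t}(A_{i,t})$ is observed. Within each batch $t$ the errors $\varepsilon_{i,t}(a)$ are mutually independent over all $i$ and $a$, with $\varepsilon_{i,t}(a)\sim\nu_{a,t}$, and the family of all errors of batch $t$ is independent of the assignments and observed outcomes of the batches $s<t$ together with the assignments $(A_{i,t})_i$ of batch $t$. Otherwise the assignments are arbitrary; in particular they, and hence the treatment shares $\pi_t=N_{1,t}/n_t$, may depend on the history in any way and may be randomized. Let $N_{a,t}=\#\{i: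 A_{i,t}=a\}$, let $\bar Y_{a,t}$ be the mean of the observed outcomes in arm $a$ of batch $t$, and put $$\hat\Delta_t=\bar Y_{1,t}-\bar Y_{0,t},\qquad v_t=\frac{\sigma_{1,t}^2}{N_{1,t}}+\frac{\sigma_{0,t}^2}{N_{0,t}},\qquad w_t=\frac1{\sqrt{v_t}},\qquad S=\sum_{s=1}^T w_s,$$ $$\hat\Delta=\sum_{t=1}^T\frac{w_t}{S}\hat\Delta_t,\qquad \mathrm{SE}(\hat\Delta)=\Big(\sum_{t=1}^T \Big(\frac{w_t}{S}\Big)^2 v_t\Big)^{1/2},\qquad z_{t,\mathrm{het}}=\frac{\hat\Delta_t-c}{\sqrt{v_t}},\qquad Z_{\mathrm{het}}=\frac{\hat\Delta-c}{\mathrm{SE}(\hat\Delta)} .$$ Suppose that $H_0:\Delta=c$ holds, that is, $\mu_{1,t}-\mu_{0,t}=c$ for all $t$, and that the batches are large in the sense that $N_{a,t}\to\infty$ in probability as $k\to\infty$ for all $a$ and $t$, i.e. $P(N_{a,t}<M)\to 0$ for every $M$. Then, whenever all $N_{a,t}$ are positive, $$Z_{\mathrm{het}}=\frac1{\sqrt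 T}\sum_{t=1}^T z_{t,\mathrm{het}},$$ and $$Z_{\mathrm{het}}\xrightarrow{d}N(0,1)\qquad (k\to\infty).$$ (On the event that some arm is empty, whose probability tends to $0$, division by zero is given the value $0$.) -/

import Mathlib

open MeasureTheory ProbabilityTheory Filter Topology

noncomputable section

/-- The random variables of a two-armed experiment run in `T` batches: batch `t` has
`size t` units, unit `i` of batch `t` is assigned to arm `assign t i` (`1` = treated,
`0` = control) and has the potential outcome `Y t i a` under arm `a`. -/
structure BatchedExperiment (T : ℕ) (Ω : Type*) where
  size : Fin T → ℕ
  assign : (t : Fin T) → Fin (size t) → Ω → Fin 2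
  Y : (t : Fin T) → Fin (size t) → Fin 2 → Ω → ℝ

namespace BatchedExperiment

variable {T : ℕ} {Ω : Type*} (E : BatchedExperiment T Ω)

/-- The observed outcome of unit `i` of batch `t`. -/
def observed (t : Fin T) (i : Fin (E.size t)) (ω : Ω) : ℝ := E.Y t i (E.assign t i ω) ω

/-- The arm size `N_{a,t}`. -/
def armCount (a : Fin 2) (t : Fin T) (ω : Ω) : ℕ :=
  (Finset.univ.filter fun i : Fin (E.size t) => E.assign t i ω = a).card

/-- The sample mean of the observed outcomes in arm `a` of batch `t`. -/
def armMean (a : Fin 2) (t : Fin T) (ω : Ω) : ℝ :=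
  (∑ i ∈ Finset.univ.filter (fun i : Fin (E.size t) => E.assign t i ω = a), E.observed t i ω) /
    (E.armCount a t ω : ℝ)

/-- The difference in sample means of batch `t`. -/
def diffMeans (t : Fin T) (ω : Ω) : ℝ := E.armMean 1 t ω - E.armMean 0 t ω

/-- `v_t = σ²_{1,t} / N_{1,t} + σ²_{0,t} / N_{0,t}`, with `σ a t` the standard deviation of
the outcomes in arm `a` of batch `t`. -/
def v (σ : Fin 2 → Fin T → ℝ) (t : Fin T) (ω : Ω) : ℝ :=
  σ 1 t ^ 2 / (E.armCount 1 t ω : ℝ) + σ 0 t ^ 2 / (E.armCount 0 t ω : ℝ)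

/-- The weight `w_t = 1 / √v_t`. -/
def w (σ : Fin 2 → Fin T → ℝ) (t : Fin T) (ω : Ω) : ℝ := 1 / √(E.v σ t ω)

/-- The sum `S` of the weights. -/
def S (σ : Fin 2 → Fin T → ℝ) (ω : Ω) : ℝ := ∑ s, E.w σ s ω

/-- The weighted average effect estimate. -/
def estimate (σ : Fin 2 → Fin T → ℝ) (ω : Ω) : ℝ :=
  ∑ t, E.w σ t ω / E.S σ ω * E.diffMeans t ω

/-- The standard error of the estimate: the square root of its variance given the
realized weights. -/
def stdErr (σ : Fin 2 → Fin T → ℝ) (ω : Ω) : ℝ :=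
  √(∑ t, (E.w σ t ω / E.S σ ω) ^ 2 * E.v σ t ω)

/-- The `z`-score of batch `t` for the hypothesis that the treatment effect is `c`. -/
def zHet (σ : Fin 2 → Fin T → ℝ) (c : ℝ) (t : Fin T) (ω : Ω) : ℝ :=
  (E.diffMeans t ω - c) / √(E.v σ t ω)

/-- The combined heteroskedastic statistic. -/
def ZHet (σ : Fin 2 → Fin T → ℝ) (c : ℝ) (ω : Ω) : ℝ :=
  (E.estimate σ ω - c) / E.stdErr σ ω

/-- The information before batch `t`: the assignments and the observed outcomes of all
earlier batches. -/
abbrev history (t : Fin T) : MeasurableSpace Ω :=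
  ⨆ s : Fin T, ⨆ _ : s < t, ⨆ i : Fin (E.size s),
    MeasurableSpace.comap (E.assign s i) inferInstance ⊔
      MeasurableSpace.comap (E.observed s i) inferInstance

/-- The information carried by the treatment assignments of batch `t`. -/
abbrev assignInfo (t : Fin T) : MeasurableSpace Ω :=
  ⨆ i : Fin (E.size t), MeasurableSpace.comap (E.assign t i) inferInstance

/-- The error `ε_{i,t}(a)` in `Y_{i,t}(a) = μ_{a,t} + ε_{i,t}(a)`. -/
def err (μ : Fin 2 → Fin T → ℝ) (t : Fin T) (i : Fin (E.size t)) (a : Fin 2) (ω : Ω) : ℝ :=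
  E.Y t i a ω - μ a t

/-- The information carried by all the errors of batch `t`. -/
abbrev errInfo (μ : Fin 2 → Fin T → ℝ) (t : Fin T) : MeasurableSpace Ω :=
  ⨆ i : Fin (E.size t), ⨆ a : Fin 2, MeasurableSpace.comap (E.err μ t i a) inferInstance

/-- The sampling model with arm means `μ a t` and error laws `ν a t`. In each batch the errors
are mutually independent over units and arms, with law `ν a t` in arm `a`, and together they are
independent of the earlier data and the current assignments. Otherwise the assignments are
unrestricted: they may depend on the history in any way and may be randomized. -/
structure IsAdaptiveSample [MeasurableSpace Ω] (P : Measure Ω)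
    (μ : Fin 2 → Fin T → ℝ) (ν : Fin 2 → Fin T → Measure ℝ) : Prop where
  measurable_assign : ∀ t i, Measurable (E.assign t i)
  measurable_Y : ∀ t i a, Measurable (E.Y t i a)
  law_err : ∀ t i a, P.map (E.err μ t i a) = ν a t
  indep_err : ∀ t, iIndepFun (fun p : Fin (E.size t) × Fin 2 => E.err μ t p.1 p.2) P
  indep_past : ∀ t, Indep (E.errInfo μ t) (E.history t ⊔ E.assignInfo t) P

end BatchedExperiment

end

/-! Since `w_t √v_t = 1`, all batches enter the combined statistic with equal weight, and under the
null the score of batch `t` is a linear combination of the errors of the observed outcomes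
(`linScore`), with coefficients determined by the assignments. The errors of batch `t` are
independent of the past and of its assignments, so with these frozen the score is a sum of
independent centered terms, of total variance exactly 1 when both arms are nonempty.

Its conditional characteristic function is therefore close to `exp (-τ² / 2)`, uniformly over all
assignment vectors with both arms large (`exists_norm_prod_charFun_sub_exp_le`). The limit does not
involve the treatment shares, so these need not converge and may depend on the history.

Freezing the assignments is a finite sum over assignment vectors (`integral_mul_exp_selected_sum`).
Peeling off the last batch multiplies the characteristic function of the earlier scores by nearly
`exp (-τ² / 2)` (`norm_integral_mul_exp_linScore_sub_le`); induction over batches, `τ = u / √T` and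
Lévy's continuity theorem give the limit. -/

/-! ### Uniform normal approximation for one arm -/

/-- Powers are Lipschitz on the closed unit disc. -/
lemma norm_pow_sub_pow_le_of_norm_le_one {z w : ℂ} (hz : ‖z‖ ≤ 1) (hw : ‖w‖ ≤ 1) (n : ℕ) :
    ‖z ^ n - w ^ n‖ ≤ n * ‖z - w‖ := by
  induction n with
  | zero => simp
  | succ n ih =>
    have h : z ^ (n + 1) - w ^ (n + 1) = z ^ n * (z - w) + (z ^ n - w ^ n) * w := by ring
    have h1 : ‖z ^ n * (z - w)‖ ≤ ‖z - w‖ := by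
      rw [norm_mul, norm_pow]
      exact mul_le_of_le_one_left (norm_nonneg _) (pow_le_one₀ (norm_nonneg _) hz)
    have h2 : ‖(z ^ n - w ^ n) * w‖ ≤ n * ‖z - w‖ := by
      rw [norm_mul]
      exact (mul_le_of_le_one_right (norm_nonneg _) hw).trans ih
    rw [h]
    push_cast
    linarith [norm_add_le (z ^ n * (z - w)) ((z ^ n - w ^ n) * w)]

/-- Second-order expansion at `0` of the characteristic function of a centered law. -/
lemma charFun_sub_isLittleO_of_centered {ν : Measure ℝ} [IsProbabilityMeasure ν]
    (hL2 : MemLp (fun x : ℝ => x) 2 ν) (hmean : ∫ x, x ∂ν = 0) :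
    (fun s : ℝ => charFun ν s - (1 - ((∫ x, x ^ 2 ∂ν : ℝ) : ℂ) * s ^ 2 / 2))
      =o[𝓝 0] fun s => s ^ 2 := by
  have hid : MemLp id (2 : ℕ) ν := hL2
  have h := taylor_isLittleO_univ (x₀ := (0 : ℝ)) (n := 2) (contDiff_charFun hid)
  refine (h.congr' ?_ ?_)
  · refine .of_forall fun s => ?_
    have := taylorWithinEval_charFun_two_zero (P := ν) (X := id) aemeasurable_id
      (by simpa using hid) s
    rw [Measure.map_id] at this
    simp only [this]
    simp [hmean]
  · exact .of_forall fun s => by simp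

/-- Uniform normal approximation of the characteristic function of a sum of `n` independent copies
of a centered variable scaled by `s`, as long as the variance `n σ² s²` of the sum is bounded. -/
lemma exists_norm_charFun_pow_sub_exp_le {ν : Measure ℝ} [IsProbabilityMeasure ν] {σ : ℝ}
    (hL2 : MemLp (fun x : ℝ => x) 2 ν) (hmean : ∫ x, x ∂ν = 0) (hvar : ∫ x, x ^ 2 ∂ν = σ ^ 2)
    (K : ℝ) {ε : ℝ} (hε : 0 < ε) :
    ∃ M : ℕ, ∀ n ≥ M, ∀ s : ℝ, n * (σ ^ 2 * s ^ 2) ≤ K →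
      ‖charFun ν s ^ n - ((Real.exp (-(n * (σ ^ 2 * s ^ 2) / 2)) : ℝ) : ℂ)‖ ≤ ε := by
  have hint : Integrable (fun x : ℝ => x ^ 2) ν := hL2.integrable_sq
  -- One arm may be degenerate: its errors then vanish almost surely. The thresholds of the other
  -- case divide by `σ ^ 2`.
  rcases eq_or_ne σ 0 with rfl | hσ
  · refine ⟨0, fun n _ s _ => ?_⟩
    have h0 : (fun x : ℝ => x) =ᵐ[ν] fun _ => 0 := by
      have := (integral_eq_zero_iff_of_nonneg (fun x => sq_nonneg x) hint).1 (by simpa using hvar)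
      filter_upwards [this] with x hx
      simpa using hx
    have h1 : charFun ν s = 1 := by
      rw [charFun_apply_real, integral_congr_ae (g := fun _ => (1 : ℂ))]
      · simp
      · filter_upwards [h0] with x hx
        simp [hx]
    simp [h1, hε.le]
  -- The Gaussian with the same variance has the same second-order expansion, and the powers of its
  -- characteristic function are exactly the target exponentials.
  · set g := gaussianReal 0 (σ ^ 2).toNNReal with hg
    have hgL2 : MemLp (fun x : ℝ => x) 2 g := memLp_id_gaussianReal 2
    have hgm : ∫ x, x ∂g = 0 := integral_id_gaussianReal
    have hgv : ∫ x, x ^ 2 ∂g = σ ^ 2 := by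
      have := variance_fun_id_gaussianReal (μ := 0) (v := (σ ^ 2).toNNReal)
      rw [variance_of_integral_eq_zero aemeasurable_id' hgm] at this
      rw [this, Real.coe_toNNReal _ (sq_nonneg σ)]
    have hgc (s : ℝ) : charFun g s = ((Real.exp (-(σ ^ 2 * s ^ 2 / 2)) : ℝ) : ℂ) := by
      rw [hg, charFun_gaussianReal, Real.coe_toNNReal _ (sq_nonneg σ)]
      push_cast
      congr 1
      ring
    have hO : (fun s : ℝ => charFun ν s - charFun g s) =o[𝓝 0] fun s => s ^ 2 := by
      refine ((charFun_sub_isLittleO_of_centered hL2 hmean).sub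
        (charFun_sub_isLittleO_of_centered hgL2 hgm)).congr_left fun s => ?_
      rw [hvar, hgv]
      ring
    have hσ2 : 0 < σ ^ 2 := by positivity
    set L := |K| + 1 with hL
    have hL0 : 0 < L := by positivity
    have hKL : K ≤ L := (le_abs_self K).trans (by linarith)
    -- With this constant, `n` errors of size `δ s²` add up to `(ε / L) (n σ² s²) ≤ ε`.
    have hδ : 0 < ε * σ ^ 2 / L := by positivity
    obtain ⟨η, hη, hb⟩ := Metric.eventually_nhds_iff.1 (hO.def hδ)
    -- Beyond this `M`, the bound `n σ² s² ≤ L` forces `|s| < η`.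
    obtain ⟨M, hM⟩ := exists_nat_gt (L / (σ ^ 2 * η ^ 2))
    have hM0 : 0 < (M : ℝ) := lt_trans (by positivity) hM
    refine ⟨M, fun n hn s hs => ?_⟩
    have hnM : (M : ℝ) ≤ n := by exact_mod_cast hn
    have hn0 : 0 < (n : ℝ) := hM0.trans_le hnM
    have hsη : |s| < η := by
      refine abs_lt_of_sq_lt_sq ?_ hη.le
      have h1 : L < n * (σ ^ 2 * η ^ 2) := by
        rw [div_lt_iff₀ (by positivity)] at hM
        exact hM.trans_le (by gcongr)
      have h2 : n * (σ ^ 2 * s ^ 2) < n * (σ ^ 2 * η ^ 2) := by linarith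
      exact lt_of_mul_lt_mul_left (lt_of_mul_lt_mul_left h2 hn0.le) hσ2.le
    have h1 := hb (y := s) (by simpa [Real.dist_eq] using hsη)
    rw [Real.norm_of_nonneg (sq_nonneg s)] at h1
    have h2 : ((Real.exp (-(n * (σ ^ 2 * s ^ 2) / 2)) : ℝ) : ℂ) = charFun g s ^ n := by
      rw [hgc, ← Complex.ofReal_pow, ← Real.exp_nat_mul]
      congr 2
      ring
    rw [h2]
    calc _ ≤ n * ‖charFun ν s - charFun g s‖ :=
          norm_pow_sub_pow_le_of_norm_le_one (norm_charFun_le_one s) (norm_charFun_le_one s) n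
      _ ≤ n * (ε * σ ^ 2 / L * s ^ 2) := by gcongr
      _ = ε / L * (n * (σ ^ 2 * s ^ 2)) := by ring
      _ ≤ ε / L * L := by gcongr; linarith
      _ = ε := by field_simp

/-! ### One batch with fixed assignments -/

/-- The number of units that the assignment vector `α` sends to arm `a`. -/
def armSize {n : ℕ} (α : Fin n → Fin 2) (a : Fin 2) : ℕ :=
  (Finset.univ.filter fun i => α i = a).card

/-- The variance of the difference in means given the assignment vector `α`. -/
noncomputable def contrastVar {n : ℕ} (σ : Fin 2 → ℝ) (α : Fin n → Fin 2) : ℝ :=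
  σ 1 ^ 2 / (armSize α 1 : ℝ) + σ 0 ^ 2 / (armSize α 0 : ℝ)

/-- The coefficient of the error of unit `i` in the standardized difference in means. -/
noncomputable def contrastCoef {n : ℕ} (σ : Fin 2 → ℝ) (α : Fin n → Fin 2) (i : Fin n) : ℝ :=
  (if α i = 1 then 1 else -1) / (armSize α (α i) * √(contrastVar σ α))

lemma contrastVar_pos {n : ℕ} {σ : Fin 2 → ℝ} (hσ : ∃ a, σ a ≠ 0) {α : Fin n → Fin 2}
    (hα : ∀ a, 0 < armSize α a) : 0 < contrastVar σ α := by
  have h0 : (0 : ℝ) < armSize α 0 := by exact_mod_cast hα 0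
  have h1 : (0 : ℝ) < armSize α 1 := by exact_mod_cast hα 1
  obtain ⟨a, ha⟩ := hσ
  unfold contrastVar
  fin_cases a
  · have : σ 0 ≠ 0 := ha
    positivity
  · have : σ 1 ≠ 0 := ha
    positivity

/-- The coefficient is constant on each arm, so the factors group into one power per arm. -/
lemma prod_charFun_contrastCoef {n : ℕ} (ν : Fin 2 → Measure ℝ) (σ : Fin 2 → ℝ)
    (α : Fin n → Fin 2) (τ : ℝ) :
    ∏ i, charFun (ν (α i)) (τ * contrastCoef σ α i) =
      charFun (ν 0) (τ * (-1 / (armSize α 0 * √(contrastVar σ α)))) ^ armSize α 0 *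
      charFun (ν 1) (τ * (1 / (armSize α 1 * √(contrastVar σ α)))) ^ armSize α 1 := by
  rw [← Finset.prod_fiberwise Finset.univ α, Fin.prod_univ_two]
  congr 1
  · rw [armSize, ← Finset.prod_const]
    refine Finset.prod_congr rfl fun i hi => ?_
    have : α i = 0 := by simpa using hi
    simp [contrastCoef, this, armSize]
  · rw [armSize, ← Finset.prod_const]
    refine Finset.prod_congr rfl fun i hi => ?_
    have : α i = 1 := by simpa using hi
    simp [contrastCoef, this, armSize]

/-- Given the assignments, the standardized difference in means is close to standard normal once
both arms are large. -/
lemma exists_norm_prod_charFun_sub_exp_le {ν : Fin 2 → Measure ℝ}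
    [∀ a, IsProbabilityMeasure (ν a)] {σ : Fin 2 → ℝ}
    (hL2 : ∀ a, MemLp (fun x : ℝ => x) 2 (ν a)) (hmean : ∀ a, ∫ x, x ∂(ν a) = 0)
    (hvar : ∀ a, ∫ x, x ^ 2 ∂(ν a) = σ a ^ 2) (hσ : ∃ a, σ a ≠ 0) (τ : ℝ) {ε : ℝ}
    (hε : 0 < ε) :
    ∃ M : ℕ, ∀ (n : ℕ) (α : Fin n → Fin 2), (∀ a, M ≤ armSize α a) →
      ‖∏ i, charFun (ν (α i)) (τ * contrastCoef σ α i) -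
        ((Real.exp (-(τ ^ 2 / 2)) : ℝ) : ℂ)‖ ≤ ε := by
  choose M hM using fun a =>
    exists_norm_charFun_pow_sub_exp_le (hL2 a) (hmean a) (hvar a) (τ ^ 2) (half_pos hε)
  -- The 1 keeps both arms nonempty, so that the variance is positive.
  refine ⟨max 1 (max (M 0) (M 1)), fun n α hα => ?_⟩
  have hpos a : 0 < armSize α a := lt_of_lt_of_le one_pos ((le_max_left _ _).trans (hα a))
  have hM0 : M 0 ≤ armSize α 0 :=
    ((le_max_left _ _).trans (le_max_right _ _)).trans (hα 0)
  have hM1 : M 1 ≤ armSize α 1 :=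
    ((le_max_right _ _).trans (le_max_right _ _)).trans (hα 1)
  have hv := contrastVar_pos hσ hpos
  have h0 : (0 : ℝ) < armSize α 0 := by exact_mod_cast hpos 0
  have h1 : (0 : ℝ) < armSize α 1 := by exact_mod_cast hpos 1
  rw [prod_charFun_contrastCoef]
  set v := contrastVar σ α with hvdef
  have hsq : √v ^ 2 = v := Real.sq_sqrt hv.le
  -- The arms' shares of the variance sum to 1 whatever the arm sizes, so the two Gaussian factors
  -- multiply to `exp (-(τ ^ 2 / 2))`; each share is at most 1, which justifies the bound `K = τ ^
  -- 2`.
  have hsum : σ 1 ^ 2 / (armSize α 1 : ℝ) / v + σ 0 ^ 2 / (armSize α 0 : ℝ) / v = 1 := by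
    rw [← add_div]
    exact div_self hv.ne'
  have e0 : armSize α 0 * (σ 0 ^ 2 * (τ * (-1 / (armSize α 0 * √v))) ^ 2) =
      τ ^ 2 * (σ 0 ^ 2 / (armSize α 0 : ℝ) / v) := by
    rw [mul_pow, div_pow, mul_pow, hsq]
    field_simp
  have e1 : armSize α 1 * (σ 1 ^ 2 * (τ * (1 / (armSize α 1 * √v))) ^ 2) =
      τ ^ 2 * (σ 1 ^ 2 / (armSize α 1 : ℝ) / v) := by
    rw [mul_pow, div_pow, mul_pow, hsq]
    field_simp
  have p0 : 0 ≤ σ 0 ^ 2 / (armSize α 0 : ℝ) / v := by positivity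
  have p1 : 0 ≤ σ 1 ^ 2 / (armSize α 1 : ℝ) / v := by positivity
  have b0 := hM 0 _ hM0 (τ * (-1 / (armSize α 0 * √v)))
    (by rw [e0]; exact mul_le_of_le_one_right (sq_nonneg τ) (by linarith))
  have b1 := hM 1 _ hM1 (τ * (1 / (armSize α 1 * √v)))
    (by rw [e1]; exact mul_le_of_le_one_right (sq_nonneg τ) (by linarith))
  rw [e0] at b0
  rw [e1] at b1
  set z0 := charFun (ν 0) (τ * (-1 / (armSize α 0 * √v))) ^ armSize α 0
  set z1 := charFun (ν 1) (τ * (1 / (armSize α 1 * √v))) ^ armSize α 1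
  set x0 := Real.exp (-(τ ^ 2 * (σ 0 ^ 2 / (armSize α 0 : ℝ) / v) / 2)) with hx0
  set x1 := Real.exp (-(τ ^ 2 * (σ 1 ^ 2 / (armSize α 1 : ℝ) / v) / 2)) with hx1
  have hz0 : ‖z0‖ ≤ 1 := by
    rw [norm_pow]
    exact pow_le_one₀ (norm_nonneg _) (norm_charFun_le_one _)
  have hx1' : ‖(x1 : ℂ)‖ ≤ 1 := by
    rw [Complex.norm_real, Real.norm_of_nonneg (Real.exp_nonneg _), Real.exp_le_one_iff]
    have := mul_nonneg (sq_nonneg τ) p1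
    linarith
  have hx : Real.exp (-(τ ^ 2 / 2)) = x0 * x1 := by
    rw [hx0, hx1, ← Real.exp_add]
    congr 1
    linear_combination (τ ^ 2 / 2) * hsum
  rw [hx, Complex.ofReal_mul, show z0 * z1 - (x0 : ℂ) * x1 = z0 * (z1 - x1) + (z0 - x0) * x1 by ring]
  refine (norm_add_le _ _).trans ?_
  rw [norm_mul, norm_mul]
  have t0 := mul_le_of_le_one_left (norm_nonneg (z1 - (x1 : ℂ))) hz0
  have t1 := mul_le_of_le_one_right (norm_nonneg (z0 - (x0 : ℂ))) hx1'
  linarith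

/-! ### Integrating out the errors -/

/-- The expectation of `F` times a complex exponential of a weighted sum of the errors selected by
the assignments is obtained by integrating out the errors. -/
lemma integral_mul_exp_selected_sum {Ω : Type*} {mE mH mΩ : MeasurableSpace Ω} {P : Measure Ω}
    [IsProbabilityMeasure P] (hmE : mE ≤ mΩ) (hmH : mH ≤ mΩ) (hind : Indep mE mH P)
    {n : ℕ} {X : Fin n → Fin 2 → Ω → ℝ} (hX : ∀ i a, Measurable[mE] (X i a))
    (hXind : iIndepFun (fun p : Fin n × Fin 2 => X p.1 p.2) P)
    {ν : Fin 2 → Measure ℝ} (hlaw : ∀ i a, P.map (X i a) = ν a)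
    {A : Fin n → Ω → Fin 2} (hA : ∀ i, Measurable[mH] (A i))
    {F : Ω → ℂ} (hF : Measurable[mH] F) (hF1 : ∀ ω, ‖F ω‖ ≤ 1)
    (g : (Fin n → Fin 2) → Fin n → ℝ) :
    ∫ ω, F ω * Complex.exp ((∑ i, g (fun j => A j ω) i * X i (A i ω) ω : ℝ) * Complex.I) ∂P =
      ∫ ω, F ω * ∏ i, charFun (ν (A i ω)) (g (fun j => A j ω) i) ∂P := by
  classical
  -- On the event that the assignment vector is `α`, both the coefficients and the choice of errors
  -- are deterministic: `G α` depends on the past and the assignments, `R α` only on the errors.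
  set G : (Fin n → Fin 2) → Ω → ℂ := fun α ω => if (fun j => A j ω) = α then F ω else 0 with hG
  have hAm : Measurable[mH] (fun ω j => A j ω) := @measurable_pi_lambda _ _ _ mH _ _ hA
  have hGm α : Measurable[mH] (G α) := by
    have hset : MeasurableSet[mH] {ω | (fun j => A j ω) = α} := hAm (measurableSet_singleton α)
    exact Measurable.ite hset hF (@measurable_const ℂ Ω _ mH 0)
  have hGn α ω : ‖G α ω‖ ≤ 1 := by
    simp only [hG]
    split_ifs
    · exact hF1 ω
    · simp
  have hGi α : Integrable (G α) P :=
    .of_bound ((hGm α).mono hmH le_rfl).aestronglyMeasurable 1 (.of_forall (hGn α))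
  set R : (Fin n → Fin 2) → Ω → ℂ := fun α ω =>
    Complex.exp ((∑ i, g α i * X i (α i) ω : ℝ) * Complex.I) with hR
  have hSm α : Measurable[mE] (fun ω => ∑ i, g α i * X i (α i) ω) :=
    @Finset.measurable_sum _ _ _ _ _ _ mE _ _ fun i _ => (hX i (α i)).const_mul _
  have hRm α : Measurable[mE] (R α) := by
    have : Measurable fun x : ℝ => Complex.exp (x * Complex.I) := by fun_prop
    exact this.comp (hSm α)
  have hRn α ω : ‖R α ω‖ ≤ 1 := (Complex.norm_exp_ofReal_mul_I _).le
  have hRint α : ∫ ω, R α ω ∂P = ∏ i, charFun (ν (α i)) (g α i) := by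
    -- Each unit contributes one potential error, so the selected errors form a subfamily of the
    -- independent family.
    have hinj : Function.Injective fun i : Fin n => (i, α i) := fun i j h => congrArg Prod.fst h
    have h1 : iIndepFun (fun i ω => g α i * X i (α i) ω) P :=
      (hXind.precomp hinj).comp (fun i x => g α i * x) fun i => measurable_const_mul _
    have hm i : AEMeasurable (fun ω => g α i * X i (α i) ω) P :=
      (((hX i (α i)).mono hmE le_rfl).const_mul _).aemeasurable
    have h2 := congrFun (h1.charFun_map_fun_sum_eq_prod hm) 1
    rw [charFun_apply_real, integral_map ((hSm α).mono hmE le_rfl).aemeasurable (by fun_prop),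
      Finset.prod_apply] at h2
    simp only [Complex.ofReal_one, one_mul] at h2
    rw [hR, h2]
    refine Finset.prod_congr rfl fun i _ => ?_
    rw [charFun_map_mul_comp ((hX i (α i)).mono hmE le_rfl).aemeasurable, hlaw, mul_one]
  have hprod α : ∫ ω, G α ω * R α ω ∂P = ∫ ω, G α ω * ∏ i, charFun (ν (α i)) (g α i) ∂P := by
    have hi : IndepFun (G α) (R α) P := by
      rw [IndepFun_iff_Indep]
      exact indep_of_indep_of_le_left (indep_of_indep_of_le_right hind.symm (hRm α).comap_le)
        (hGm α).comap_le
    rw [hi.integral_fun_mul_eq_mul_integral (hGi α).aestronglyMeasurable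
      ((hRm α).mono hmE le_rfl).aestronglyMeasurable, hRint, integral_mul_const]
  have e1 ω : F ω * Complex.exp ((∑ i, g (fun j => A j ω) i * X i (A i ω) ω : ℝ) * Complex.I) =
      ∑ α, G α ω * R α ω := by
    simp [hG, hR, ite_mul]
  have e2 ω : F ω * ∏ i, charFun (ν (A i ω)) (g (fun j => A j ω) i) =
      ∑ α, G α ω * ∏ i, charFun (ν (α i)) (g α i) := by
    simp [hG, ite_mul]
  simp_rw [e1, e2]
  rw [integral_finsetSum, integral_finsetSum]
  · exact Finset.sum_congr rfl fun α _ => hprod α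
  · exact fun α _ => (hGi α).mul_const _
  · exact fun α _ => (hGi α).mul_bdd ((hRm α).mono hmE le_rfl).aestronglyMeasurable
      (.of_forall (hRn α))

/-! ### Algebra of the statistic -/

namespace BatchedExperiment

variable {T : ℕ} {Ω : Type*} (E : BatchedExperiment T Ω)

/-- The standardized difference in means of batch `t`, written as a linear combination of the
errors of the observed outcomes. -/
noncomputable def linScore (μ σ : Fin 2 → Fin T → ℝ) (t : Fin T) (ω : Ω) : ℝ :=
  ∑ i, contrastCoef (fun a => σ a t) (fun j => E.assign t j ω) i *
    E.err μ t i (E.assign t i ω) ω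

variable {E}

lemma v_pos {σ : Fin 2 → Fin T → ℝ} {t : Fin T} {ω : Ω} (hσ : ∃ a, σ a t ≠ 0)
    (hpos : ∀ a, 0 < E.armCount a t ω) : 0 < E.v σ t ω :=
  contrastVar_pos (σ := fun a => σ a t) (α := fun i => E.assign t i ω) hσ hpos

lemma armMean_eq_add (μ : Fin 2 → Fin T → ℝ) {a : Fin 2} {t : Fin T} {ω : Ω}
    (hpos : 0 < E.armCount a t ω) :
    E.armMean a t ω =
      (∑ i ∈ Finset.univ.filter (fun i => E.assign t i ω = a),
        E.err μ t i (E.assign t i ω) ω) / (E.armCount a t ω : ℝ) + μ a t := by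
  have h : (E.armCount a t ω : ℝ) ≠ 0 := by exact_mod_cast hpos.ne'
  have hs : ∑ i ∈ Finset.univ.filter (fun i => E.assign t i ω = a), E.observed t i ω =
      (∑ i ∈ Finset.univ.filter (fun i => E.assign t i ω = a),
        E.err μ t i (E.assign t i ω) ω) + E.armCount a t ω * μ a t := by
    rw [armCount, ← nsmul_eq_mul, ← Finset.sum_const, ← Finset.sum_add_distrib]
    refine Finset.sum_congr rfl fun i hi => ?_
    have : E.assign t i ω = a := by simpa using hi
    simp [err, observed, this]
  rw [armMean, hs, add_div, mul_div_cancel_left₀ _ h]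

/-- The arm means contribute `μ 1 t - μ 0 t`, which cancels `c`; only errors remain. -/
lemma zHet_eq_linScore {μ σ : Fin 2 → Fin T → ℝ} {c : ℝ} {t : Fin T} {ω : Ω}
    (hnull : μ 1 t - μ 0 t = c) (hpos : ∀ a, 0 < E.armCount a t ω) :
    E.zHet σ c t ω = E.linScore μ σ t ω := by
  have hv : contrastVar (fun a => σ a t) (fun i => E.assign t i ω) = E.v σ t ω := rfl
  have hN a : armSize (fun i => E.assign t i ω) a = E.armCount a t ω := rfl
  have hfib a : ∑ i ∈ Finset.univ.filter (fun i => E.assign t i ω = a),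
      contrastCoef (fun a => σ a t) (fun j => E.assign t j ω) i *
        E.err μ t i (E.assign t i ω) ω =
      (if a = 1 then 1 else -1) / (E.armCount a t ω * √(E.v σ t ω)) *
        ∑ i ∈ Finset.univ.filter (fun i => E.assign t i ω = a),
          E.err μ t i (E.assign t i ω) ω := by
    rw [Finset.mul_sum]
    refine Finset.sum_congr rfl fun i hi => ?_
    have : E.assign t i ω = a := by simpa using hi
    rw [contrastCoef, hv, this, hN]
  rw [linScore, ← Finset.sum_fiberwise Finset.univ (fun i => E.assign t i ω), Fin.sum_univ_two,
    hfib, hfib, zHet, diffMeans, armMean_eq_add μ (hpos 0), armMean_eq_add μ (hpos 1), ← hnull]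
  simp only [zero_ne_one, if_false, if_true]
  rw [← div_div, ← div_div]
  ring

/-- Because `w_t √v_t = 1`, the centered estimate is the sum of the scores over `S`, and each batch
adds `1 / S²` to the squared standard error, which is therefore `T / S²`; `S` cancels. -/
lemma ZHet_eq_sum_zHet (hT : 0 < T) {σ : Fin 2 → Fin T → ℝ} (hσ : ∀ t, ∃ a, σ a t ≠ 0) (c : ℝ)
    {ω : Ω} (hpos : ∀ a t, 0 < E.armCount a t ω) :
    E.ZHet σ c ω = 1 / √(T : ℝ) * ∑ t, E.zHet σ c t ω := by
  have hv t : 0 < E.v σ t ω := v_pos (hσ t) fun a => hpos a t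
  have hw t : 0 < E.w σ t ω := one_div_pos.2 (Real.sqrt_pos.2 (hv t))
  have hS : 0 < E.S σ ω := Finset.sum_pos (fun t _ => hw t) ⟨⟨0, hT⟩, Finset.mem_univ _⟩
  have hTs : 0 < √(T : ℝ) := Real.sqrt_pos.2 (by exact_mod_cast hT)
  have hest : E.estimate σ ω - c = (∑ t, E.zHet σ c t ω) / E.S σ ω := by
    have hsum : ∑ t, E.w σ t ω / E.S σ ω = 1 := by
      rw [← Finset.sum_div]
      exact div_self hS.ne'
    calc E.estimate σ ω - c
        = E.estimate σ ω - (∑ t, E.w σ t ω / E.S σ ω) * c := by rw [hsum, one_mul]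
      _ = _ := by
        rw [estimate, Finset.sum_mul, ← Finset.sum_sub_distrib, Finset.sum_div]
        refine Finset.sum_congr rfl fun t _ => ?_
        rw [zHet, w]
        ring
  have hse : E.stdErr σ ω = √(T : ℝ) / E.S σ ω := by
    have h t : (E.w σ t ω / E.S σ ω) ^ 2 * E.v σ t ω = 1 / E.S σ ω ^ 2 := by
      have := hv t
      rw [w, div_pow, div_pow, Real.sq_sqrt this.le]
      field_simp
    rw [stdErr, Finset.sum_congr rfl fun t _ => h t, Finset.sum_const, Finset.card_univ,
      Fintype.card_fin, nsmul_eq_mul, mul_one_div, Real.sqrt_div (by positivity),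
      Real.sqrt_sq hS.le]
  rw [ZHet, hest, hse]
  field_simp

/-! ### Measurability -/

/-- The error in the assigned arm can be recovered from observed data. Hence past scores are
measurable for the history, although it contains no unobserved outcomes. -/
lemma err_assign_eq (μ : Fin 2 → Fin T → ℝ) (t : Fin T) (i : Fin (E.size t)) :
    (fun ω => E.err μ t i (E.assign t i ω) ω) =
      fun ω => E.observed t i ω - μ (E.assign t i ω) t := rfl

lemma measurable_linScore_of {m : MeasurableSpace Ω} {t : Fin T} (μ σ : Fin 2 → Fin T → ℝ)
    (hA : ∀ i, Measurable (E.assign t i)) (hO : ∀ i, Measurable (E.observed t i)) :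
    Measurable (E.linScore μ σ t) := by
  refine Finset.measurable_sum _ fun i _ => Measurable.mul ?_ ?_
  · exact (measurable_of_finite fun α : Fin (E.size t) → Fin 2 =>
      contrastCoef (fun a => σ a t) α i).comp (measurable_pi_lambda _ hA)
  · rw [err_assign_eq]
    exact (hO i).sub ((measurable_of_finite fun a => μ a t).comp (hA i))

lemma measurable_assign_history {s t : Fin T} (hst : s < t) (i : Fin (E.size s)) :
    Measurable[E.history t] (E.assign s i) :=
  Measurable.of_comap_le (le_sup_left.trans
    (le_iSup_of_le s (le_iSup_of_le hst (le_iSup_of_le i le_rfl))))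

lemma measurable_observed_history {s t : Fin T} (hst : s < t) (i : Fin (E.size s)) :
    Measurable[E.history t] (E.observed s i) :=
  Measurable.of_comap_le (le_sup_right.trans
    (le_iSup_of_le s (le_iSup_of_le hst (le_iSup_of_le i le_rfl))))

lemma measurable_linScore_history (μ σ : Fin 2 → Fin T → ℝ) {s t : Fin T} (hst : s < t) :
    Measurable[E.history t] (E.linScore μ σ s) :=
  @measurable_linScore_of _ _ _ (E.history t) _ μ σ (measurable_assign_history hst)
    (measurable_observed_history hst)

namespace IsAdaptiveSample

variable [mΩ : MeasurableSpace Ω] {P : Measure Ω} {μ : Fin 2 → Fin T → ℝ}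
  {ν : Fin 2 → Fin T → Measure ℝ}

lemma measurable_observed (h : E.IsAdaptiveSample P μ ν) (t : Fin T) (i : Fin (E.size t)) :
    Measurable (E.observed t i) := by
  have : E.observed t i = fun ω => ∑ a, if E.assign t i ω = a then E.Y t i a ω else 0 := by
    ext ω
    simp [observed]
  rw [this]
  refine Finset.measurable_sum _ fun a _ => Measurable.ite ?_ (h.measurable_Y t i a) measurable_const
  exact h.measurable_assign t i (measurableSet_singleton a)

lemma measurable_err (h : E.IsAdaptiveSample P μ ν) (t : Fin T) (i : Fin (E.size t)) (a : Fin 2) :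
    Measurable (E.err μ t i a) := (h.measurable_Y t i a).sub_const _

lemma measurable_linScore (h : E.IsAdaptiveSample P μ ν) (σ : Fin 2 → Fin T → ℝ) (t : Fin T) :
    Measurable (E.linScore μ σ t) :=
  measurable_linScore_of μ σ (h.measurable_assign t) (h.measurable_observed t)

lemma history_le (h : E.IsAdaptiveSample P μ ν) (t : Fin T) : E.history t ≤ mΩ :=
  iSup_le fun s => iSup_le fun _ => iSup_le fun i =>
    sup_le (h.measurable_assign s i).comap_le (h.measurable_observed s i).comap_le

lemma assignInfo_le (h : E.IsAdaptiveSample P μ ν) (t : Fin T) : E.assignInfo t ≤ mΩ :=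
  iSup_le fun i => (h.measurable_assign t i).comap_le

lemma errInfo_le (h : E.IsAdaptiveSample P μ ν) (t : Fin T) : E.errInfo μ t ≤ mΩ :=
  iSup_le fun i => iSup_le fun a => (h.measurable_err t i a).comap_le

lemma measurable_armCount (h : E.IsAdaptiveSample P μ ν) (a : Fin 2) (t : Fin T) :
    Measurable (E.armCount a t) :=
  (measurable_of_finite fun α : Fin (E.size t) → Fin 2 => armSize α a).comp
    (measurable_pi_lambda _ (h.measurable_assign t))

lemma measurable_armMean (h : E.IsAdaptiveSample P μ ν) (a : Fin 2) (t : Fin T) :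
    Measurable (E.armMean a t) := by
  refine Measurable.div ?_ (measurable_from_top.comp (h.measurable_armCount a t))
  simp_rw [Finset.sum_filter]
  refine Finset.measurable_sum _ fun i _ =>
    Measurable.ite ?_ (h.measurable_observed t i) measurable_const
  exact h.measurable_assign t i (measurableSet_singleton a)

lemma measurable_v (h : E.IsAdaptiveSample P μ ν) (σ : Fin 2 → Fin T → ℝ) (t : Fin T) :
    Measurable (E.v σ t) :=
  (measurable_const.div (measurable_from_top.comp (h.measurable_armCount 1 t))).add
    (measurable_const.div (measurable_from_top.comp (h.measurable_armCount 0 t)))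

lemma measurable_ZHet (h : E.IsAdaptiveSample P μ ν) (σ : Fin 2 → Fin T → ℝ) (c : ℝ) :
    Measurable (E.ZHet σ c) := by
  have hv := h.measurable_v σ
  have hw t : Measurable (E.w σ t) := measurable_const.div (hv t).sqrt
  have hS : Measurable (E.S σ) := Finset.measurable_sum _ fun t _ => hw t
  have hd t : Measurable (E.diffMeans t) := (h.measurable_armMean 1 t).sub (h.measurable_armMean 0 t)
  refine Measurable.div (Measurable.sub_const ?_ _) (Measurable.sqrt ?_)
  · exact Finset.measurable_sum _ fun t _ => ((hw t).div hS).mul (hd t)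
  · exact Finset.measurable_sum _ fun t _ => (((hw t).div hS).pow_const 2).mul (hv t)

/-! ### Peeling off one batch -/

/-- One batch: multiplying a function of the past by the complex exponential of the score of
batch `t` changes its expectation by nearly the factor `exp (-τ² / 2)`. -/
lemma norm_integral_mul_exp_linScore_sub_le [IsProbabilityMeasure P]
    [∀ a t, IsProbabilityMeasure (ν a t)] (h : E.IsAdaptiveSample P μ ν)
    (σ : Fin 2 → Fin T → ℝ) (t : Fin T) (τ : ℝ) {ε : ℝ} {M : ℕ}
    (hM : ∀ (n : ℕ) (α : Fin n → Fin 2), (∀ a, M ≤ armSize α a) →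
      ‖∏ i, charFun (ν (α i) t) (τ * contrastCoef (fun a => σ a t) α i) -
        ((Real.exp (-(τ ^ 2 / 2)) : ℝ) : ℂ)‖ ≤ ε) (hε : 0 ≤ ε)
    {F : Ω → ℂ} (hF : Measurable[E.history t] F) (hF1 : ∀ ω, ‖F ω‖ ≤ 1) :
    ‖∫ ω, F ω * Complex.exp ((τ * E.linScore μ σ t ω : ℝ) * Complex.I) ∂P -
      (∫ ω, F ω ∂P) * ((Real.exp (-(τ ^ 2 / 2)) : ℝ) : ℂ)‖ ≤
      ε + ∑ a, 2 * P.real {ω | E.armCount a t ω < M} := by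
  set e : ℂ := ((Real.exp (-(τ ^ 2 / 2)) : ℝ) : ℂ) with he
  set ψ : Ω → ℂ := fun ω => ∏ i, charFun (ν (E.assign t i ω) t)
    (τ * contrastCoef (fun a => σ a t) (fun j => E.assign t j ω) i) with hψ
  have hsel := integral_mul_exp_selected_sum (h.errInfo_le t)
    (sup_le (h.history_le t) (h.assignInfo_le t)) (h.indep_past t)
    (X := fun i a => E.err μ t i a)
    (fun i a => Measurable.of_comap_le (le_iSup_of_le i (le_iSup_of_le a le_rfl)))
    (h.indep_err t) (ν := fun a => ν a t) (h.law_err t)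
    (A := fun i => E.assign t i)
    (fun i => Measurable.of_comap_le ((le_iSup_of_le i le_rfl : _ ≤ E.assignInfo t).trans
      le_sup_right))
    (hF.mono le_sup_left le_rfl) hF1
    (fun α i => τ * contrastCoef (fun a => σ a t) α i)
  have hscore ω : τ * E.linScore μ σ t ω =
      ∑ i, τ * contrastCoef (fun a => σ a t) (fun j => E.assign t j ω) i *
        E.err μ t i (E.assign t i ω) ω := by
    simp_rw [linScore, Finset.mul_sum, mul_assoc]
  have hFi : Integrable F P :=
    .of_bound (hF.mono (h.history_le t) le_rfl).aestronglyMeasurable 1 (.of_forall hF1)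
  have hψm : Measurable ψ :=
    (measurable_of_finite fun α : Fin (E.size t) → Fin 2 =>
      ∏ i, charFun (ν (α i) t) (τ * contrastCoef (fun a => σ a t) α i)).comp
      (measurable_pi_lambda _ (h.measurable_assign t))
  have hψ1 ω : ‖ψ ω‖ ≤ 1 := by
    rw [hψ, norm_prod]
    exact Finset.prod_le_one (fun _ _ => norm_nonneg _) fun _ _ => norm_charFun_le_one _
  have he1 : ‖e‖ ≤ 1 := by
    rw [he, Complex.norm_real, Real.norm_of_nonneg (Real.exp_nonneg _), Real.exp_le_one_iff]
    have := sq_nonneg τ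
    linarith
  have hms a : MeasurableSet {ω | E.armCount a t ω < M} :=
    measurableSet_lt (h.measurable_armCount a t) measurable_const
  simp_rw [hscore]
  rw [hsel, ← integral_mul_const, ← integral_sub (hFi.mul_bdd hψm.aestronglyMeasurable
    (.of_forall hψ1)) (hFi.mul_const e)]
  have hbound ω : ‖F ω * ψ ω - F ω * e‖ ≤
      ε + ∑ a, {ω | E.armCount a t ω < M}.indicator (fun _ => (2 : ℝ)) ω := by
    have hind a ω : 0 ≤ {ω | E.armCount a t ω < M}.indicator (fun _ => (2 : ℝ)) ω :=
      Set.indicator_nonneg (fun _ _ => zero_le_two) ω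
    rw [← mul_sub, norm_mul]
    refine (mul_le_of_le_one_left (norm_nonneg _) (hF1 ω)).trans ?_
    by_cases hω : ∀ a, M ≤ E.armCount a t ω
    · exact (hM _ (fun i => E.assign t i ω) hω).trans
        (le_add_of_nonneg_right (Finset.sum_nonneg fun a _ => hind a ω))
    -- When some arm is small, only the trivial bound `‖ψ - e‖ ≤ 2` is available; the indicator of
    -- that arm pays for it.
    · push Not at hω
      obtain ⟨a, ha⟩ := hω
      have h2 := Finset.single_le_sum (fun a _ => hind a ω) (Finset.mem_univ a)
      rw [Set.indicator_of_mem (by exact ha)] at h2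
      linarith [norm_sub_le (ψ ω) e, hψ1 ω]
  have hindi a : Integrable ({ω | E.armCount a t ω < M}.indicator (fun _ => (2 : ℝ))) P :=
    (integrable_const _).indicator (hms a)
  have hsumi : Integrable (fun ω => ∑ a, {ω | E.armCount a t ω < M}.indicator
      (fun _ => (2 : ℝ)) ω) P := integrable_finsetSum _ fun a _ => hindi a
  refine (norm_integral_le_of_norm_le (g := fun ω => ε + ∑ a, {ω | E.armCount a t ω < M}.indicator
      (fun _ => (2 : ℝ)) ω) ((integrable_const ε).add hsumi)
    (.of_forall hbound)).trans_eq ?_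
  rw [integral_add (integrable_const ε) hsumi, integral_finsetSum _ fun a _ => hindi a]
  simp [integral_indicator_const, hms, mul_comm]

end IsAdaptiveSample

end BatchedExperiment

/-! ### Limits along the sequence of experiments -/

namespace BatchedExperiment

variable {T : ℕ} {Ω : ℕ → Type*} [∀ k, MeasurableSpace (Ω k)] {P : ∀ k, Measure (Ω k)}
  {E : ∀ k, BatchedExperiment T (Ω k)}

lemma tendsto_measureReal_armCount_lt
    (hlarge : ∀ a t, ∀ M : ℕ, Tendsto (fun k => P k {ω | (E k).armCount a t ω < M}) atTop (𝓝 0))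
    (a : Fin 2) (t : Fin T) (M : ℕ) :
    Tendsto (fun k => (P k).real {ω | (E k).armCount a t ω < M}) atTop (𝓝 0) := by
  exact (ENNReal.tendsto_toReal ENNReal.zero_ne_top).comp (hlarge a t M)

variable [∀ k, IsProbabilityMeasure (P k)] {μ σ : Fin 2 → Fin T → ℝ}
  {ν : Fin 2 → Fin T → Measure ℝ} [∀ a t, IsProbabilityMeasure (ν a t)]

/-- The characteristic function of the sum of the scores of the first `j` batches converges to
that of `j` independent standard normal variables. -/
lemma tendsto_integral_exp_sum_linScore
    (hL2 : ∀ a t, MemLp (fun x : ℝ => x) 2 (ν a t)) (hmean : ∀ a t, ∫ x, x ∂(ν a t) = 0)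
    (hvar : ∀ a t, ∫ x, x ^ 2 ∂(ν a t) = σ a t ^ 2) (hσ : ∀ t, ∃ a, σ a t ≠ 0)
    (hE : ∀ k, (E k).IsAdaptiveSample (P k) μ ν)
    (hlarge : ∀ a t, ∀ M : ℕ, Tendsto (fun k => P k {ω | (E k).armCount a t ω < M}) atTop (𝓝 0))
    (τ : ℝ) {j : ℕ} (hj : j ≤ T) :
    Tendsto (fun k => ∫ ω, Complex.exp
      ((∑ s : Fin T with s.val < j, τ * (E k).linScore μ σ s ω : ℝ) * Complex.I) ∂(P k)) atTop
      (𝓝 (((Real.exp (-(τ ^ 2 / 2)) : ℝ) : ℂ) ^ j)) := by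
  induction j with
  | zero => simp
  | succ j ih =>
    -- Batches are numbered from 0: those with index below `j` are exactly the ones before `t`, so
    -- `F` is measurable for the history of `t`.
    set t : Fin T := ⟨j, hj⟩ with ht
    set F : ∀ k, Ω k → ℂ := fun k ω => Complex.exp
      ((∑ s : Fin T with s.val < j, τ * (E k).linScore μ σ s ω : ℝ) * Complex.I) with hF
    have hfilter : (Finset.univ.filter fun s : Fin T => s.val < j + 1) =
        insert t (Finset.univ.filter fun s : Fin T => s.val < j) := by
      ext s
      simp [ht, Fin.ext_iff]
      omega
    have hsplit k ω : Complex.exp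
        ((∑ s : Fin T with s.val < j + 1, τ * (E k).linScore μ σ s ω : ℝ) * Complex.I) =
        F k ω * Complex.exp ((τ * (E k).linScore μ σ t ω : ℝ) * Complex.I) := by
      rw [hfilter, Finset.sum_insert (by simp [ht]), hF, ← Complex.exp_add, Complex.ofReal_add]
      ring_nf
    have hFm k : Measurable[(E k).history t] (F k) := by
      have h1 : Measurable fun x : ℝ => Complex.exp (x * Complex.I) := by fun_prop
      have h2 : Measurable[(E k).history t]
          fun ω => ∑ s : Fin T with s.val < j, τ * (E k).linScore μ σ s ω :=
        @Finset.measurable_sum _ _ _ _ _ _ ((E k).history t) _ _ fun s hs =>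
          (measurable_linScore_history μ σ (by simpa [ht, Fin.lt_def] using hs)).const_mul _
      exact h1.comp h2
    have hF1 k ω : ‖F k ω‖ ≤ 1 := (Complex.norm_exp_ofReal_mul_I _).le
    simp_rw [hsplit]
    have hlim : Tendsto (fun k => (∫ ω, F k ω ∂(P k)) * ((Real.exp (-(τ ^ 2 / 2)) : ℝ) : ℂ)) atTop
        (𝓝 (((Real.exp (-(τ ^ 2 / 2)) : ℝ) : ℂ) ^ (j + 1))) := by
      rw [pow_succ]
      exact (ih (by omega)).mul_const _
    have hdiff : Tendsto (fun k =>
        ∫ ω, F k ω * Complex.exp ((τ * (E k).linScore μ σ t ω : ℝ) * Complex.I) ∂(P k) -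
          (∫ ω, F k ω ∂(P k)) * ((Real.exp (-(τ ^ 2 / 2)) : ℝ) : ℂ)) atTop (𝓝 0) := by
      rw [Metric.tendsto_nhds]
      intro δ hδ
      -- `M` does not depend on `k`, so the probability of an arm smaller than `M` can then be sent
      -- to 0.
      obtain ⟨M, hM⟩ := exists_norm_prod_charFun_sub_exp_le (fun a => hL2 a t)
        (fun a => hmean a t) (fun a => hvar a t) (hσ t) τ (half_pos hδ)
      have hP : Tendsto (fun k => ∑ a, 2 * (P k).real {ω | (E k).armCount a t ω < M}) atTop
          (𝓝 0) := by
        simpa using tendsto_finsetSum Finset.univ fun a _ =>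
          (tendsto_measureReal_armCount_lt hlarge a t M).const_mul 2
      filter_upwards [hP.eventually_lt_const (half_pos hδ)] with k hk
      rw [dist_zero_right]
      have := (hE k).norm_integral_mul_exp_linScore_sub_le σ t τ hM (half_pos hδ).le (hFm k) (hF1 k)
      linarith
    simpa only [sub_add_cancel, zero_add] using hdiff.add hlim

/-- Changing a random variable on an event of small probability changes its characteristic
function little. -/
lemma norm_charFun_map_sub_integral_exp_le {Ω : Type*} {m : MeasurableSpace Ω} {P : Measure Ω}
    [IsProbabilityMeasure P] {X Y : Ω → ℝ} (hX : Measurable X) (hY : Measurable Y)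
    {B : Set Ω} (hB : MeasurableSet B) (hXY : ∀ ω ∉ B, X ω = Y ω) (u : ℝ) :
    ‖charFun (P.map X) u - ∫ ω, Complex.exp ((u * Y ω : ℝ) * Complex.I) ∂P‖ ≤
      2 * P.real B := by
  have hint {Z : Ω → ℝ} (hZ : Measurable Z) :
      Integrable (fun ω => Complex.exp ((u * Z ω : ℝ) * Complex.I)) P := by
    refine .of_bound (by fun_prop) 1 (.of_forall fun ω => ?_)
    exact (Complex.norm_exp_ofReal_mul_I _).le
  rw [charFun_apply_real, integral_map hX.aemeasurable (by fun_prop)]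
  simp_rw [← Complex.ofReal_mul]
  rw [← integral_sub (hint hX) (hint hY)]
  refine (norm_integral_le_of_norm_le (g := B.indicator fun _ => (2 : ℝ))
    ((integrable_const _).indicator hB) (.of_forall fun ω => ?_)).trans_eq ?_
  · by_cases hω : ω ∈ B
    · rw [Set.indicator_of_mem hω]
      refine (norm_sub_le _ _).trans ?_
      rw [Complex.norm_exp_ofReal_mul_I, Complex.norm_exp_ofReal_mul_I]
      norm_num
    · simp [Set.indicator_of_notMem hω, hXY ω hω]
  · simp [integral_indicator_const, hB, mul_comm]

/-- The characteristic function of the combined statistic converges to the Gaussian one. -/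
lemma tendsto_charFun_map_ZHet (hT : 0 < T)
    (hL2 : ∀ a t, MemLp (fun x : ℝ => x) 2 (ν a t)) (hmean : ∀ a t, ∫ x, x ∂(ν a t) = 0)
    (hvar : ∀ a t, ∫ x, x ^ 2 ∂(ν a t) = σ a t ^ 2) (hσ : ∀ t, ∃ a, σ a t ≠ 0)
    {c : ℝ} (hnull : ∀ t, μ 1 t - μ 0 t = c)
    (hE : ∀ k, (E k).IsAdaptiveSample (P k) μ ν)
    (hlarge : ∀ a t, ∀ M : ℕ, Tendsto (fun k => P k {ω | (E k).armCount a t ω < M}) atTop (𝓝 0))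
    (u : ℝ) :
    Tendsto (fun k => charFun ((P k).map ((E k).ZHet σ c)) u) atTop
      (𝓝 (charFun (gaussianReal 0 1) u)) := by
  set Y : ∀ k, Ω k → ℝ := fun k ω => 1 / √(T : ℝ) * ∑ t, (E k).linScore μ σ t ω with hY
  -- Off the event of an empty arm the statistic equals `Y`; on it, the value given by division by
  -- zero is irrelevant.
  set B : ∀ k, Set (Ω k) := fun k => ⋃ a, ⋃ t, {ω | (E k).armCount a t ω < 1} with hB
  have hBm k : MeasurableSet (B k) := MeasurableSet.iUnion fun a => MeasurableSet.iUnion fun t =>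
    measurableSet_lt ((hE k).measurable_armCount a t) measurable_const
  have hYm k : Measurable (Y k) :=
    (Finset.measurable_sum _ fun t _ => (hE k).measurable_linScore σ t).const_mul _
  have hZY k ω (hω : ω ∉ B k) : (E k).ZHet σ c ω = Y k ω := by
    have hpos a t : 0 < (E k).armCount a t ω := by
      by_contra h
      exact hω (Set.mem_iUnion₂.2 ⟨a, t, by simpa using h⟩)
    rw [ZHet_eq_sum_zHet hT hσ c hpos, hY]
    congr 1
    exact Finset.sum_congr rfl fun t _ => zHet_eq_linScore (hnull t) fun a => hpos a t
  have hBlim : Tendsto (fun k => 2 * (P k).real (B k)) atTop (𝓝 0) := by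
    have hle k : (P k).real (B k) ≤ ∑ a, ∑ t, (P k).real {ω | (E k).armCount a t ω < 1} :=
      (measureReal_iUnion_fintype_le _).trans
        (Finset.sum_le_sum fun a _ => measureReal_iUnion_fintype_le _)
    have hsum : Tendsto (fun k => ∑ a, ∑ t, (P k).real {ω | (E k).armCount a t ω < 1}) atTop
        (𝓝 0) := by
      simpa using tendsto_finsetSum Finset.univ fun a _ => tendsto_finsetSum Finset.univ
        fun t _ => tendsto_measureReal_armCount_lt hlarge a t 1
    simpa using (squeeze_zero (fun k => measureReal_nonneg) hle hsum).const_mul 2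
  have hYlim : Tendsto (fun k => ∫ ω, Complex.exp ((u * Y k ω : ℝ) * Complex.I) ∂(P k)) atTop
      (𝓝 (charFun (gaussianReal 0 1) u)) := by
    -- At `τ = u / √T` each of the `T` batches contributes a factor `exp (-u² / (2T))`.
    have h := tendsto_integral_exp_sum_linScore hL2 hmean hvar hσ hE hlarge (u / √(T : ℝ)) le_rfl
    have hlim : ((Real.exp (-((u / √(T : ℝ)) ^ 2 / 2)) : ℝ) : ℂ) ^ T =
        charFun (gaussianReal 0 1) u := by
      have hT' : (T : ℝ) ≠ 0 := by exact_mod_cast hT.ne'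
      rw [charFun_gaussianReal, ← Complex.ofReal_pow, ← Real.exp_nat_mul, div_pow,
        Real.sq_sqrt (Nat.cast_nonneg T)]
      have : (T : ℝ) * -(u ^ 2 / T / 2) = -(u ^ 2 / 2) := by field_simp
      rw [this]
      push_cast
      congr 1
      simp
    rw [hlim] at h
    refine h.congr fun k => integral_congr_ae (.of_forall fun ω => ?_)
    simp only [Fin.is_lt, Finset.filter_true, ← Finset.mul_sum, hY]
    congr 3
    ring
  have hdiff := squeeze_zero_norm
    (fun k => norm_charFun_map_sub_integral_exp_le (P := P k) ((hE k).measurable_ZHet σ c)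
      (hYm k) (hBm k) (hZY k) u) hBlim
  simpa using hdiff.add hYlim

end BatchedExperiment

theorem theorem1 {T : ℕ} (hT : 0 < T)
    {Ω : ℕ → Type*} [∀ k, MeasurableSpace (Ω k)]
    (P : ∀ k, Measure (Ω k)) [∀ k, IsProbabilityMeasure (P k)]
    (μ σ : Fin 2 → Fin T → ℝ)
    (ν : Fin 2 → Fin T → Measure ℝ) [∀ a t, IsProbabilityMeasure (ν a t)]
    (hL2 : ∀ a t, MemLp (fun x : ℝ => x) 2 (ν a t))
    (hmean : ∀ a t, ∫ x, x ∂(ν a t) = 0)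
    (hvar : ∀ a t, ∫ x, x ^ 2 ∂(ν a t) = σ a t ^ 2)
    (hσ : ∀ t, ∃ a, σ a t ≠ 0)
    (c : ℝ) (hnull : ∀ t, μ 1 t - μ 0 t = c)
    (E : ∀ k, BatchedExperiment T (Ω k))
    (hE : ∀ k, (E k).IsAdaptiveSample (P k) μ ν)
    (hlarge : ∀ a t, ∀ M : ℕ,
      Tendsto (fun k => P k {ω | (E k).armCount a t ω < M}) atTop (𝓝 0)) :
    (∀ k ω, (∀ a t, 0 < (E k).armCount a t ω) →
      (E k).ZHet σ c ω = 1 / √(T : ℝ) * ∑ t, (E k).zHet σ c t ω) ∧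
    TendstoInDistribution (fun k => (E k).ZHet σ c) atTop (fun x : ℝ => x) P
      (gaussianReal 0 1) := by
  refine ⟨fun k ω hpos => BatchedExperiment.ZHet_eq_sum_zHet hT hσ c hpos,
    fun k => ((hE k).measurable_ZHet σ c).aemeasurable, aemeasurable_id', ?_⟩
  -- Lévy's continuity theorem.
  refine ProbabilityMeasure.tendsto_of_tendsto_charFun fun u => ?_
  have h := BatchedExperiment.tendsto_charFun_map_ZHet hT hL2 hmean hvar hσ hnull hE hlarge u
  simpa only [ProbabilityMeasure.coe_mk, Measure.map_id'] using h
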